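/- A non-compact locally compact Cantor set is a non-compact locally compact metrizable space without isolated points that has a countable basis of compact open sets. For a Borel measure $\mu$ on such a space $X$, let $$\mathfrak M_\mu=\{x\in X:\mu(U)=\infty\text{ for every compact open }U\ni x\},\qquad S(\mu)=\{\mu(U): U\subset X\text{ compact open},\ \mu(U)<\infty\}.$$ The measure $\mu$ is non-defective if $\mu(X)=\infty$ and $\mu(\mathfrak M_\mu)=0$. Let $M^0(X)$ be the class of Borel measures on $X$ that are full (non-empty open sets have positive measure), non-atomic (points have measure zero), and either finite or non-defective. A measure $\mu\in M^0(X)$ is good if for all compact open $U,V\subset X$ with $\mu(U)<\mu(V)$ there is a compact open $W\subset V$ with $\mu(W)=\mu(U)$. For $a\in(0,\infty]$, a countable dense subset $D$ of $[0,a)$ is group-like if $D=G\cap[0,a)$ for some additive subgroup $G$ of $\mathbb R$. A metrizable space is zero-dimensional if its clopen subsets form a basis of its topology; the empty space is allowed. **Theorem.** (1) Let $X$ be a non-compact locally compact Cantor set and let $\mu\in M^0(X)$ be good. Then $S(\mu)$ is a countable dense group-like subset of $[0,\mu(X))$, and $\mathfrak M_\mu$ (with the induced topology) is a locally compact, zero-dimensional,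 separable metrizable space (possibly empty). (2) Conversely, for every countable dense group-like subset $D$ of $[0,1)$ there are a non-compact locally compact Cantor set $X$ and a good probability measure $\mu\in M^0(X)$ with $S(\mu)=D$. (3) For every countable dense group-like subset $D$ of $[0,\infty)$ and every locally compact, zero-dimensional, separable metric space $A$ (possibly empty) there are a non-compact locally compact Cantor set $X$ and a good non-defective measure $\mu\in M^0(X)$ such that $S(\mu)=D$ and $\mathfrak M_\mu$ is homeomorphic to $A$. -/

import Mathlib

open MeasureTheory TopologicalSpace
open scoped ENNReal

namespace LCCantor

/-- `X` is a non-compact locally compact Cantor set: a non-compact locally compact metrizable space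
without isolated points that has a countable basis of compact open sets. -/
structure IsNoncompactLCCantor (X : Type*) [TopologicalSpace X] : Prop where
  metrizable : MetrizableSpace X
  locallyCompact : LocallyCompactSpace X
  noncompact : NoncompactSpace X
  no_isolated_points : ∀ x : X, ¬ IsOpen ({x} : Set X)
  exists_basis : ∃ B : Set (Set X), B.Countable ∧ IsTopologicalBasis B ∧
    ∀ U ∈ B, IsCompact U ∧ IsOpen U

/-- `A` is a locally compact, zero-dimensional, separable metrizable space (possibly empty).
Zero-dimensional means that the clopen sets form a basis of the topology. -/
structure IsLCZeroDimSepMetrizable (A : Type*) [TopologicalSpace A] : Prop where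
  metrizable : MetrizableSpace A
  separable : SeparableSpace A
  locallyCompact : LocallyCompactSpace A
  zeroDim : IsTopologicalBasis {U : Set A | IsClopen U}

section measures

variable {X : Type*} [TopologicalSpace X] [MeasurableSpace X]

/-- The defective set of `μ`: the points all of whose compact open neighbourhoods have infinite
measure. -/
def defectiveSet (μ : Measure X) : Set X :=
  {x | ∀ U : Set X, IsCompact U → IsOpen U → x ∈ U → μ U = ∞}

/-- The measure `μ` is non-defective: it is infinite, and its defective set is null. -/
def IsNondefective (μ : Measure X) : Prop :=
  μ Set.univ = ∞ ∧ μ (defectiveSet μ) = 0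

/-- The class of full non-atomic measures that are finite or non-defective. -/
structure MemMZero (μ : Measure X) : Prop where
  full : ∀ U : Set X, IsOpen U → U.Nonempty → 0 < μ U
  nonatomic : ∀ x : X, μ {x} = 0
  finite_or_nondefective : μ Set.univ < ∞ ∨ IsNondefective μ

/-- The compact open values set of `μ`: the finite values of `μ` on compact open sets. -/
def compactOpenValues (μ : Measure X) : Set ℝ :=
  {r | ∃ U : Set X, IsCompact U ∧ IsOpen U ∧ μ U < ∞ ∧ r = (μ U).toReal}

/-- The set `V` is good for `μ`. -/
def IsGoodSet (μ : Measure X) (V : Set X) : Prop :=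
  ∀ U : Set X, IsCompact U → IsOpen U → μ U < μ V →
    ∃ W : Set X, IsCompact W ∧ IsOpen W ∧ W ⊆ V ∧ μ W = μ U

/-- The measure `μ` is good: every compact open set is good for `μ`. -/
def IsGood (μ : Measure X) : Prop :=
  ∀ V : Set X, IsCompact V → IsOpen V → IsGoodSet μ V

end measures

/-- The real interval `[0, a)`, where `a` may be infinite. -/
def halfOpen (a : ℝ≥0∞) : Set ℝ :=
  {x | 0 ≤ x ∧ ENNReal.ofReal x < a}

/-- `D` is a countable dense group-like subset of `[0, a)`, where `a ∈ (0, ∞]`: it is a countable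
dense subset of `[0, a)` of the form `G ∩ [0, a)` for an additive subgroup `G` of `ℝ`. -/
structure IsGroupLike (D : Set ℝ) (a : ℝ≥0∞) : Prop where
  pos : 0 < a
  countable : D.Countable
  subset : D ⊆ halfOpen a
  dense : halfOpen a ⊆ closure D
  exists_subgroup : ∃ G : AddSubgroup ℝ, D = (G : Set ℝ) ∩ halfOpen a

end LCCantor

namespace LCCantor

/-! For a good measure, realising one value inside a set carrying a larger one makes `S(μ)` closed
under differences; finding two disjoint realisations inside a large compact open set makes it closed
under sums below `μ(X)`. Such large sets exist because the compact open sets of finite measure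
exhaust `X` up to the null defective set (`MemMZero.exists_lt_measure`). Non-atomicity gives small
values, and `isGroupLike_of_closed` finishes.

Conversely, double the points of `D` in `[0, a)`: points become initial segments of `D`, and an
interval with endpoints in `D` becomes a compact open cell whose measure is its length. A cofinal
sequence `c` divides the line into compact blocks. Block `n` receives a label `r n` in `A ⊕ ℕ`, and
a copy of `A` is added at the end of the line. Labels visiting every open subset of `A` infinitely
often, on blocks of length bounded below, make each point of this copy defective; labels escaping to
infinity in `ℕ` prevent compactness. A compact open set missing `A` is a finite disjoint union of
cells, so its measure lies in `G` and it can be cut at every smaller non-negative element of `G`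
(`isDivisible_of_disjoint`). Goodness and the value set follow by truncating to finitely many
blocks. -/

lemma mem_halfOpen_of_le {a : ℝ≥0∞} {x y : ℝ} (hx : 0 ≤ x) (hxy : x ≤ y) (hy : y ∈ halfOpen a) :
    x ∈ halfOpen a :=
  ⟨hx, (ENNReal.ofReal_le_ofReal hxy).trans_lt hy.2⟩

/-! ### Arithmetic of group-like sets. -/

lemma sub_mul_mem {S : Set ℝ} (hsub : ∀ s ∈ S, ∀ t ∈ S, s ≤ t → t - s ∈ S) {s t : ℝ} (hs : s ∈ S)
    (ht : t ∈ S) (k : ℕ) (hk : k * t ≤ s) (h0 : 0 ≤ t) : s - k * t ∈ S := by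
  induction k with
  | zero => simpa using hs
  | succ k ih =>
    push_cast at hk ⊢
    have := hsub t ht _ (ih (by nlinarith)) (by linarith)
    convert this using 1; ring

lemma add_mul_mem {S : Set ℝ} {a : ℝ≥0∞}
    (hadd : ∀ s ∈ S, ∀ t ∈ S, ENNReal.ofReal (s + t) < a → s + t ∈ S) {s t : ℝ} (hs : s ∈ S)
    (ht : t ∈ S) (h0 : 0 ≤ t) (k : ℕ) (hk : ENNReal.ofReal (s + k * t) < a) :
    s + k * t ∈ S := by
  induction k with
  | zero => simpa using hs
  | succ k ih =>
    push_cast at hk ⊢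
    have e : s + (k + 1) * t = s + k * t + t := by ring
    rw [e] at hk ⊢
    exact hadd _ (ih ((ENNReal.ofReal_le_ofReal (by linarith)).trans_lt hk)) _ ht hk

/-- A subset of `[0, a)` containing arbitrarily small positive numbers which is closed under
differences, and under sums inside `[0, a)`, is group-like. -/
lemma isGroupLike_of_closed {S : Set ℝ} {a : ℝ≥0∞} (ha : 0 < a) (hc : S.Countable)
    (hS : S ⊆ halfOpen a) (h0 : (0 : ℝ) ∈ S) (hsmall : ∀ ε > 0, ∃ s ∈ S, 0 < s ∧ s < ε)
    (hsub : ∀ s ∈ S, ∀ t ∈ S, s ≤ t → t - s ∈ S)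
    (hadd : ∀ s ∈ S, ∀ t ∈ S, ENNReal.ofReal (s + t) < a → s + t ∈ S) : IsGroupLike S a := by
  refine ⟨ha, hc, hS, ?_, ?_⟩
  · intro x hx
    rw [Metric.mem_closure_iff]
    intro ε hε
    obtain ⟨s, hs, hs0, hsε⟩ := hsmall ε hε
    have h1 : ⌊x / s⌋₊ * s ≤ x := by
      have := Nat.floor_le (div_nonneg hx.1 hs0.le)
      rwa [le_div_iff₀ hs0] at this
    have h2 : x < (⌊x / s⌋₊ + 1) * s := by
      have := Nat.lt_floor_add_one (x / s)
      rwa [div_lt_iff₀ hs0] at this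
    refine ⟨0 + ⌊x / s⌋₊ * s, add_mul_mem hadd h0 hs hs0.le _ ?_, ?_⟩
    · rw [zero_add]
      exact (ENNReal.ofReal_le_ofReal h1).trans_lt hx.2
    · rw [Real.dist_eq, abs_lt]
      constructor <;> linarith
  · obtain ⟨e, he0, hea⟩ : ∃ e : ℝ, 0 < e ∧ ENNReal.ofReal e < a := by
      obtain ⟨q, hq, hq'⟩ := ENNReal.lt_iff_exists_nnreal_btwn.1 ha
      exact ⟨q, by exact_mod_cast hq, by simpa using hq'⟩
    -- With `2 * t < e`, the sum of two remainders below `t` stays in `[0, a)`; the group will be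
    -- the integer multiples of `t` plus remainders from `S` below `t`.
    obtain ⟨t, ht, ht0, hte⟩ := hsmall (e / 2) (by positivity)
    have hta : ∀ x, x ≤ 2 * t → ENNReal.ofReal x < a := fun x hx =>
      (ENNReal.ofReal_le_ofReal (by linarith)).trans_lt hea
    have red : ∀ s ∈ S, ∃ k : ℕ, s - k * t ∈ S ∧ s - k * t < t := by
      intro s hs
      have h1 : ⌊s / t⌋₊ * t ≤ s := by
        have := Nat.floor_le (div_nonneg (hS hs).1 ht0.le)
        rwa [le_div_iff₀ ht0] at this
      have h2 : s < (⌊s / t⌋₊ + 1) * t := by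
        have := Nat.lt_floor_add_one (s / t)
        rwa [div_lt_iff₀ ht0] at this
      exact ⟨_, sub_mul_mem hsub hs ht _ h1 ht0.le, by linarith⟩
    have key : ∀ (n : ℤ), ∀ s ∈ S, ∃ (m : ℤ), ∃ u ∈ S, u < t ∧ n * t + s = m * t + u := by
      intro n s hs
      obtain ⟨k, hk, hk'⟩ := red s hs
      exact ⟨n + k, _, hk, hk', by push_cast; ring⟩
    let G : AddSubgroup ℝ :=
      { carrier := {g | ∃ n : ℤ, ∃ s ∈ S, s < t ∧ g = n * t + s}
        zero_mem' := ⟨0, 0, h0, ht0, by simp⟩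
        add_mem' := by
          rintro _ _ ⟨n, s, hs, hst, rfl⟩ ⟨n', s', hs', hst', rfl⟩
          obtain ⟨m, u, hu, hut, h⟩ := key (n + n') (s + s')
            (hadd _ hs _ hs' (hta _ (by linarith)))
          exact ⟨m, u, hu, hut, by rw [← h]; push_cast; ring⟩
        neg_mem' := by
          rintro _ ⟨n, s, hs, hst, rfl⟩
          obtain ⟨m, u, hu, hut, h⟩ := key (-n - 1) (t - s) (hsub _ hs _ ht hst.le)
          exact ⟨m, u, hu, hut, by rw [← h]; push_cast; ring⟩ }
    refine ⟨G, Set.Subset.antisymm (fun s hs => ⟨?_, hS hs⟩) ?_⟩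
    · obtain ⟨m, u, hu, hut, h⟩ := key 0 s hs
      exact ⟨m, u, hu, hut, by rw [← h]; simp⟩
    · rintro _ ⟨⟨n, s, hs, hst, rfl⟩, hg0, hga⟩
      have hn : 0 ≤ n := by
        by_contra! hn
        have : (n : ℝ) ≤ -1 := by exact_mod_cast Int.le_sub_one_of_lt hn
        nlinarith
      lift n to ℕ using hn
      have := add_mul_mem hadd hs ht ht0.le n (by rw [add_comm]; exact_mod_cast hga)
      rw [add_comm] at this
      exact_mod_cast this

/-! ### Compact open sets and the values of a good measure. -/

section

variable {X : Type*} [TopologicalSpace X]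

lemma IsNoncompactLCCantor.countable_compactOpens (h : IsNoncompactLCCantor X) :
    {U : Set X | IsCompact U ∧ IsOpen U}.Countable := by
  obtain ⟨B, hBc, hB, hBK⟩ := h.exists_basis
  have : {U : Set X | IsCompact U ∧ IsOpen U} ⊆
      (fun s : Set (Set X) => ⋃₀ s) '' {s | s.Finite ∧ s ⊆ B} := by
    rintro U ⟨hUc, hUo⟩
    obtain ⟨s, hs, rfl⟩ := eq_finite_iUnion_of_isTopologicalBasis_of_isCompact_open
      (Subtype.val : B → Set X) (by simpa using hB) U hUc hUo
    exact ⟨Subtype.val '' s, ⟨hs.image _, by simp⟩, by simp [Set.sUnion_image]⟩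
  refine (Set.Countable.image ?_ _).mono this
  exact Set.countable_ofPred_finite_subset hBc

lemma IsNoncompactLCCantor.exists_compactOpen_subset (h : IsNoncompactLCCantor X) {x : X}
    {U : Set X} (hU : IsOpen U) (hx : x ∈ U) :
    ∃ V, IsCompact V ∧ IsOpen V ∧ x ∈ V ∧ V ⊆ U := by
  obtain ⟨B, -, hB, hBK⟩ := h.exists_basis
  obtain ⟨V, hV, hxV, hVU⟩ := hB.exists_subset_of_mem_open hx hU
  exact ⟨V, (hBK V hV).1, (hBK V hV).2, hxV, hVU⟩

variable [MeasurableSpace X] {μ : Measure X}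

lemma isClosed_defectiveSet : IsClosed (defectiveSet μ) := by
  rw [← isOpen_compl_iff, isOpen_iff_forall_mem_open]
  intro x hx
  simp only [defectiveSet, Set.mem_compl_iff, Set.mem_ofPred_eq, not_forall] at hx
  obtain ⟨U, hUc, hUo, hxU, hU⟩ := hx
  exact ⟨U, fun y hy hy' => hU (hy' U hUc hUo hy), hUo, hxU⟩

lemma isLCZeroDimSepMetrizable_defectiveSet (h : IsNoncompactLCCantor X) :
    IsLCZeroDimSepMetrizable (defectiveSet μ) := by
  have := h.metrizable
  have := h.locallyCompact
  obtain ⟨B, hBc, hB, hBK⟩ := h.exists_basis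
  have := hB.secondCountableTopology hBc
  refine ⟨inferInstance, inferInstance, isClosed_defectiveSet.locallyCompactSpace, ?_⟩
  refine isTopologicalBasis_of_isOpen_of_nhds (fun U hU => hU.isOpen) ?_
  rintro x U hxU hU
  obtain ⟨V, hV, rfl⟩ := isOpen_induced_iff.1 hU
  obtain ⟨W, hWc, hWo, hxW, hWV⟩ := h.exists_compactOpen_subset hV hxU
  exact ⟨Subtype.val ⁻¹' W, ⟨hWc.isClosed.preimage continuous_subtype_val,
    hWo.preimage continuous_subtype_val⟩, hxW, fun y hy => hWV hy⟩

lemma MemMZero.measure_defectiveSet (h : IsNoncompactLCCantor X) (hμ : MemMZero μ) :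
    μ (defectiveSet μ) = 0 := by
  rcases hμ.finite_or_nondefective with hf | hn
  · have : defectiveSet μ = ∅ := by
      refine Set.eq_empty_of_forall_notMem fun x hx => ?_
      obtain ⟨U, hUc, hUo, hxU, -⟩ := h.exists_compactOpen_subset isOpen_univ (Set.mem_univ x)
      exact ((measure_mono (Set.subset_univ U)).trans_lt hf).ne (hx U hUc hUo hxU)
    simp [this]
  · exact hn.2

/-- Compact open sets of finite measure form a countable directed family whose union is the
complement of the null defective set, so continuity from below applies. -/
lemma MemMZero.exists_lt_measure (h : IsNoncompactLCCantor X) (hμ : MemMZero μ) {b : ℝ≥0∞}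
    (hb : b < μ Set.univ) : ∃ K, IsCompact K ∧ IsOpen K ∧ μ K < ∞ ∧ b < μ K := by
  let 𝒦 : Set (Set X) := {K | (IsCompact K ∧ IsOpen K) ∧ μ K < ∞}
  have hc : 𝒦.Countable := h.countable_compactOpens.mono fun K hK => hK.1
  have hd : DirectedOn (Function.onFun (· ⊆ ·) id) 𝒦 := fun K hK K' hK' =>
    ⟨K ∪ K', ⟨⟨hK.1.1.union hK'.1.1, hK.1.2.union hK'.1.2⟩,
      measure_union_lt_top hK.2 hK'.2⟩, Set.subset_union_left, Set.subset_union_right⟩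
  have hu : (⋃ K ∈ 𝒦, id K) = (defectiveSet μ)ᶜ := by
    ext x
    simp only [𝒦, defectiveSet, Set.mem_iUnion, Set.mem_compl_iff, Set.mem_ofPred_eq,
      not_forall, id]
    constructor
    · rintro ⟨K, ⟨⟨h1, h2⟩, h3⟩, hx⟩
      exact ⟨K, h1, h2, hx, h3.ne⟩
    · rintro ⟨K, h1, h2, hx, h3⟩
      exact ⟨K, ⟨⟨h1, h2⟩, lt_top_iff_ne_top.2 h3⟩, hx⟩
  have hm : μ (defectiveSet μ)ᶜ = μ Set.univ :=
    measure_congr (by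
      rw [Filter.eventuallyEq_univ]
      simpa [mem_ae_iff] using hμ.measure_defectiveSet h)
  rw [← hm, ← hu, measure_biUnion_eq_iSup hc hd] at hb
  simp only [lt_iSup_iff] at hb
  obtain ⟨K, hK, hbK⟩ := hb
  exact ⟨K, hK.1.1, hK.1.2, hK.2, hbK⟩

lemma ofReal_mem_of_mem_compactOpenValues {s : ℝ} (hs : s ∈ compactOpenValues μ) :
    0 ≤ s ∧ ∃ U, IsCompact U ∧ IsOpen U ∧ μ U = ENNReal.ofReal s := by
  obtain ⟨U, hUc, hUo, hU, rfl⟩ := hs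
  exact ⟨ENNReal.toReal_nonneg, U, hUc, hUo, (ENNReal.ofReal_toReal hU.ne).symm⟩

lemma mem_compactOpenValues {s : ℝ} (hs : 0 ≤ s) {U : Set X} (hUc : IsCompact U) (hUo : IsOpen U)
    (hU : μ U = ENNReal.ofReal s) : s ∈ compactOpenValues μ :=
  ⟨U, hUc, hUo, by simp [hU], by rw [hU, ENNReal.toReal_ofReal hs]⟩

variable [BorelSpace X]

lemma MemMZero.measure_lt_univ [NoncompactSpace X] [T2Space X] (hμ : MemMZero μ) {U : Set X}
    (hUc : IsCompact U) (hU : μ U < ∞) : μ U < μ Set.univ := by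
  have hne : (Uᶜ).Nonempty := by
    rw [Set.nonempty_compl]
    rintro rfl
    exact noncompact_univ X hUc
  have := hμ.full Uᶜ hUc.isClosed.isOpen_compl hne
  rw [← measure_add_measure_compl hUc.isClosed.measurableSet]
  exact ENNReal.lt_add_right hU.ne this.ne'

lemma MemMZero.exists_small (h : IsNoncompactLCCantor X) (hμ : MemMZero μ) {ε : ℝ≥0∞}
    (hε : 0 < ε) : ∃ U, IsCompact U ∧ IsOpen U ∧ 0 < μ U ∧ μ U < ε := by
  have := h.metrizable
  have := h.noncompact
  have hne : (Set.univ : Set X).Nonempty := by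
    rw [Set.nonempty_iff_ne_empty]
    intro e
    exact noncompact_univ X (e ▸ isCompact_empty)
  obtain ⟨K, hKc, hKo, hKf, hK0⟩ := hμ.exists_lt_measure h (hμ.full _ isOpen_univ hne)
  obtain ⟨x, hx⟩ := nonempty_of_measure_ne_zero hK0.ne'
  -- Restricting to `K` gives a finite measure, for which outer regularity at the null set `{x}` is
  -- available.
  have : IsFiniteMeasure (μ.restrict K) := ⟨by simpa using hKf⟩
  obtain ⟨V, hxV, hVo, hV⟩ := Set.exists_isOpen_lt_of_lt ({x} : Set X) (μ := μ.restrict K) ε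
    (by rwa [nonpos_iff_eq_zero.1 ((Measure.restrict_apply_le K {x}).trans (hμ.nonatomic x).le)])
  obtain ⟨U, hUc, hUo, hxU, hU⟩ := h.exists_compactOpen_subset (hKo.inter hVo)
    ⟨hx, hxV rfl⟩
  refine ⟨U, hUc, hUo, hμ.full U hUo ⟨x, hxU⟩, ?_⟩
  calc μ U ≤ μ (V ∩ K) := measure_mono fun y hy => ⟨(hU hy).2, (hU hy).1⟩
    _ ≤ μ.restrict K V := Measure.le_restrict_apply K V
    _ < ε := hV

theorem IsGood.isGroupLike (h : IsNoncompactLCCantor X) (hμ : MemMZero μ) (hg : IsGood μ) :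
    IsGroupLike (compactOpenValues μ) (μ Set.univ) := by
  have := h.metrizable
  have := h.noncompact
  have h0 : (0 : ℝ) ∈ compactOpenValues μ :=
    mem_compactOpenValues le_rfl isCompact_empty isOpen_empty (by simp)
  have hsubset : compactOpenValues μ ⊆ halfOpen (μ Set.univ) := by
    intro s hs
    obtain ⟨hs0, U, hUc, hUo, hU⟩ := ofReal_mem_of_mem_compactOpenValues hs
    exact ⟨hs0, hU ▸ hμ.measure_lt_univ hUc (by simp [hU])⟩
  have hinside : ∀ s ∈ compactOpenValues μ, ∀ V, IsCompact V → IsOpen V →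
      ENNReal.ofReal s ≤ μ V → ∃ W, IsCompact W ∧ IsOpen W ∧ W ⊆ V ∧ μ W = ENNReal.ofReal s := by
    intro s hs V hVc hVo hsV
    obtain ⟨hs0, U, hUc, hUo, hU⟩ := ofReal_mem_of_mem_compactOpenValues hs
    rcases hsV.eq_or_lt with e | hlt
    · exact ⟨V, hVc, hVo, subset_rfl, e.symm⟩
    · rw [← hU] at hlt ⊢
      exact hg V hVc hVo U hUc hUo hlt
  refine isGroupLike_of_closed ((hsubset h0).2.trans_le' (by simp)) ?_ hsubset h0 ?_ ?_ ?_
  · refine (h.countable_compactOpens.image fun U => (μ U).toReal).mono ?_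
    rintro _ ⟨U, hUc, hUo, -, rfl⟩
    exact ⟨U, ⟨hUc, hUo⟩, rfl⟩
  · intro ε hε
    obtain ⟨U, hUc, hUo, h1, h2⟩ := hμ.exists_small h (ENNReal.ofReal_pos.2 hε)
    have hf : μ U < ∞ := h2.trans ENNReal.ofReal_lt_top
    refine ⟨_, ⟨U, hUc, hUo, hf, rfl⟩, ENNReal.toReal_pos h1.ne' hf.ne, ?_⟩
    exact (ENNReal.lt_ofReal_iff_toReal_lt hf.ne).1 h2
  · intro s hs t ht hst
    obtain ⟨hs0, -⟩ := ofReal_mem_of_mem_compactOpenValues hs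
    obtain ⟨ht0, V, hVc, hVo, hV⟩ := ofReal_mem_of_mem_compactOpenValues ht
    obtain ⟨W, hWc, hWo, hWV, hW⟩ := hinside s hs V hVc hVo
      (hV ▸ ENNReal.ofReal_le_ofReal hst)
    refine mem_compactOpenValues (by linarith) (hVc.diff hWo) (hVo.sdiff hWc.isClosed) ?_
    rw [measure_sdiff hWV hWc.isClosed.measurableSet.nullMeasurableSet (by simp [hW]), hV, hW,
      ENNReal.ofReal_sub _ hs0]
  · intro s hs t ht hst
    obtain ⟨hs0, -⟩ := ofReal_mem_of_mem_compactOpenValues hs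
    obtain ⟨ht0, -⟩ := ofReal_mem_of_mem_compactOpenValues ht
    -- `K` has room for both: after `s` is realised in `K`, the rest still has measure at least `t`.
    obtain ⟨K, hKc, hKo, hKf, hK⟩ := hμ.exists_lt_measure h hst
    obtain ⟨W, hWc, hWo, hWK, hW⟩ := hinside s hs K hKc hKo
      ((ENNReal.ofReal_le_ofReal (by linarith)).trans hK.le)
    have hdiff : ENNReal.ofReal t ≤ μ (K \ W) := by
      rw [measure_sdiff hWK hWc.isClosed.measurableSet.nullMeasurableSet (by simp [hW]), hW]
      refine ENNReal.le_sub_of_add_le_left (by simp) ?_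
      rw [← ENNReal.ofReal_add hs0 ht0]
      exact hK.le
    obtain ⟨W', hWc', hWo', hWK', hW'⟩ := hinside t ht _ (hKc.diff hWo) (hKo.sdiff hWc.isClosed)
      hdiff
    refine mem_compactOpenValues (by linarith) (hWc.union hWc') (hWo.union hWo') ?_
    rw [measure_union (Set.disjoint_sdiff_right.mono_right hWK') hWc'.isClosed.measurableSet, hW,
      hW', ENNReal.ofReal_add hs0 ht0]

end

lemma locallyCompactSpace_sum (A B : Type*) [TopologicalSpace A] [TopologicalSpace B] [T2Space A]
    [T2Space B] [LocallyCompactSpace A] [LocallyCompactSpace B] : LocallyCompactSpace (A ⊕ B) := by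
  have : WeaklyLocallyCompactSpace (A ⊕ B) := by
    refine ⟨?_⟩
    rintro (a | b)
    · obtain ⟨K, hK, hKa⟩ := exists_compact_mem_nhds a
      exact ⟨Sum.inl '' K, hK.image continuous_inl,
        Topology.IsOpenEmbedding.inl.image_mem_nhds.2 hKa⟩
    · obtain ⟨K, hK, hKb⟩ := exists_compact_mem_nhds b
      exact ⟨Sum.inr '' K, hK.image continuous_inr,
        Topology.IsOpenEmbedding.inr.image_mem_nhds.2 hKb⟩
  infer_instance

/-! ### The glued space and its cells. -/

section

variable {A : Type*} {D : Set ℝ}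

/-- The pairs `(p, L)` where `L` is (the indicator of) an initial segment of `D` such that
`p = r n` if `L` ends between `c n` and `c (n + 1)`, and `p` lies in `A` if `L = D`. -/
def gluedSet (r : ℕ → A ⊕ ℕ) (c : ℕ → D) : Set ((A ⊕ ℕ) × (D → Bool)) :=
  {x | (∀ g h, g ≤ h → x.2 h = true → x.2 g = true) ∧ x.2 (c 0) = true ∧
    (∀ n, x.2 (c n) = true → x.2 (c (n + 1)) = false → x.1 = r n) ∧
    ∀ k, x.1 = Sum.inr k → x.2 (c (k + 1)) = false}

/-- The half-open interval with the points of `D` doubled, glued to `A` at infinity: the Cantor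
sets between `c n` and `c (n + 1)` accumulate at the points of `A` as prescribed by `r`. -/
def Glued (r : ℕ → A ⊕ ℕ) (c : ℕ → D) : Type _ := gluedSet r c

variable {r : ℕ → A ⊕ ℕ} {c : ℕ → D}

namespace Glued

/-- The component in `A ⊕ ℕ`. -/
def base (x : Glued r c) : A ⊕ ℕ := x.1.1

/-- The initial segment of `D`. -/
def cut (x : Glued r c) : D → Bool := x.1.2

lemma ext {x y : Glued r c} (h1 : x.base = y.base) (h2 : x.cut = y.cut) : x = y :=
  Subtype.ext (Prod.ext h1 h2)

lemma cut_of_le {x : Glued r c} {g h : D} (hgh : g ≤ h) (hx : x.cut h = true) : x.cut g = true :=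
  x.2.1 g h hgh hx

lemma not_cut_of_le {x : Glued r c} {g h : D} (hgh : g ≤ h) (hx : x.cut g = false) :
    x.cut h = false := by
  by_contra hne
  rw [Bool.not_eq_false] at hne
  simp [cut_of_le hgh hne] at hx

lemma lt_of_cut {x : Glued r c} {g h : D} (hg : x.cut g = true) (hh : x.cut h = false) :
    g < h := by
  by_contra! hle
  simp [cut_of_le hle hg] at hh

lemma cut_zero (x : Glued r c) : x.cut (c 0) = true := x.2.2.1

lemma base_eq {x : Glued r c} {n : ℕ} (h : x.cut (c n) = true) (h' : x.cut (c (n + 1)) = false) :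
    x.base = r n :=
  x.2.2.2.1 n h h'

lemma cut_of_base_eq_inr {x : Glued r c} {k : ℕ} (h : x.base = Sum.inr k) :
    x.cut (c (k + 1)) = false :=
  x.2.2.2.2 k h

/-- The points between `p` and `q`. -/
def cell (p q : D) : Set (Glued r c) := {x | x.cut p = true ∧ x.cut q = false}

/-- The points of the copy of `A` at infinity. -/
def topSet : Set (Glued r c) := {x | ∀ g, x.cut g = true}

lemma base_of_mem_topSet {x : Glued r c} (hx : x ∈ topSet) : ∃ α, x.base = Sum.inl α := by
  cases hb : x.base with
  | inl α => exact ⟨α, rfl⟩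
  | inr k => simpa [hx (c (k + 1))] using cut_of_base_eq_inr hb

lemma cell_self (p : D) : (cell p p : Set (Glued r c)) = ∅ := by
  ext x; simp [cell]

/-- An interval minus an interval leaves a left and a right piece; clamping `p'` and `q'` to `[p,
q]` covers all relative positions at once. -/
lemma cell_sdiff_cell (p q p' q' : D) (h : p ≤ q) :
    (cell p q \ cell p' q' : Set (Glued r c)) =
      cell p (max p (min q p')) ∪ cell (max p (min q q')) q := by
  ext x
  simp only [cell, Set.mem_sdiff, Set.mem_ofPred_eq, Set.mem_union, not_and, Bool.not_eq_false]
  have hle : ∀ {g h : D}, g ≤ h → x.cut h = true → x.cut g = true := fun h1 h2 => cut_of_le h1 h2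
  have hp : ∀ b, b = true ∨ b = false := by decide
  rcases le_total q p' with h1 | h1 <;> rcases le_total q q' with h2 | h2 <;>
    rcases le_total p p' with h3 | h3 <;> rcases le_total p q' with h4 | h4 <;>
    simp only [min_eq_left h1, min_eq_right h1, min_eq_left h2, min_eq_right h2,
      max_eq_right h, max_eq_left h3, max_eq_right h3, max_eq_left h4,
      max_eq_right h4] <;> grind

/-- The point `(inl α, D)`. -/
def ofTop (α : A) : Glued r c :=
  ⟨(Sum.inl α, fun _ => true), by simp [gluedSet]⟩

lemma range_ofTop : Set.range (ofTop : A → Glued r c) = topSet := by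
  ext x
  constructor
  · rintro ⟨α, rfl⟩ g
    rfl
  · intro hx
    obtain ⟨α, hα⟩ := base_of_mem_topSet hx
    exact ⟨α, ext hα.symm (funext fun g => (hx g).symm)⟩

variable [TopologicalSpace A]

instance : TopologicalSpace (Glued r c) := inferInstanceAs (TopologicalSpace (gluedSet r c))

instance : MeasurableSpace (Glued r c) := borel _

instance : BorelSpace (Glued r c) := ⟨rfl⟩

lemma isEmbedding_val : Topology.IsEmbedding
    (fun x : Glued r c => ((x.base, x.cut) : (A ⊕ ℕ) × (D → Bool))) :=
  Topology.IsEmbedding.subtypeVal (p := fun x => x ∈ gluedSet r c)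

lemma continuous_base : Continuous (base : Glued r c → A ⊕ ℕ) :=
  isEmbedding_val.continuous.fst

lemma continuous_cut : Continuous (cut : Glued r c → D → Bool) :=
  isEmbedding_val.continuous.snd

lemma isClopen_cut (p : D) (b : Bool) : IsClopen {x : Glued r c | x.cut p = b} :=
  (isClopen_discrete {b}).preimage ((continuous_apply p).comp continuous_cut)

lemma isClopen_cell (p q : D) : IsClopen (cell p q : Set (Glued r c)) :=
  (isClopen_cut p true).inter (isClopen_cut q false)

lemma isEmbedding_ofTop : Topology.IsEmbedding (ofTop : A → Glued r c) := by
  refine Topology.IsEmbedding.of_comp (g := base) ?_ continuous_base Topology.IsEmbedding.inl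
  exact Continuous.subtype_mk (continuous_inl.prodMk continuous_const) _

lemma isClosed_gluedSet [T2Space A] : IsClosed (gluedSet r c) := by
  have h2 : ∀ (g : D) (b : Bool), IsClopen {x : (A ⊕ ℕ) × (D → Bool) | x.2 g = b} := fun g b =>
    (isClopen_discrete {b}).preimage ((continuous_apply g).comp continuous_snd)
  have himp : ∀ {s t : Set ((A ⊕ ℕ) × (D → Bool))}, IsOpen s → IsClosed t →
      IsClosed {x | x ∈ s → x ∈ t} := fun hs ht => isClosed_imp hs ht
  have hinr : ∀ k, IsOpen {x : (A ⊕ ℕ) × (D → Bool) | x.1 = Sum.inr k} := by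
    intro k
    have : IsOpen (Sum.inr '' ({k} : Set ℕ) : Set (A ⊕ ℕ)) :=
      Topology.IsOpenEmbedding.inr.isOpenMap _ (isOpen_discrete _)
    rw [Set.image_singleton] at this
    exact this.preimage continuous_fst
  have e : gluedSet r c = (⋂ g, ⋂ h, {x | g ≤ h → x.2 h = true → x.2 g = true}) ∩
      ({x | x.2 (c 0) = true} ∩
      ((⋂ n, {x | x.2 (c n) = true → x.2 (c (n + 1)) = false → x.1 = r n}) ∩
      ⋂ k, {x | x.1 = Sum.inr k → x.2 (c (k + 1)) = false})) := by
    ext x; simp [gluedSet]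
  rw [e]
  refine IsClosed.inter ?_ (IsClosed.inter (h2 _ _).isClosed (IsClosed.inter ?_ ?_))
  · refine isClosed_iInter fun g => isClosed_iInter fun h => ?_
    by_cases hgh : g ≤ h
    · simp only [hgh, true_imp_iff]
      exact himp (h2 h true).isOpen (h2 g true).isClosed
    · simp [hgh]
  · refine isClosed_iInter fun n => ?_
    exact himp (h2 _ true).isOpen (himp (h2 _ false).isOpen
      (isClosed_eq continuous_fst continuous_const))
  · exact isClosed_iInter fun k => himp (hinr k) (h2 _ false).isClosed

lemma isClosedEmbedding_val [T2Space A] : Topology.IsClosedEmbedding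
    (fun x : Glued r c => ((x.base, x.cut) : (A ⊕ ℕ) × (D → Bool))) :=
  isClosed_gluedSet.isClosedEmbedding_subtypeVal

/-- Inside block `n` the base is constantly `r n`, so the cell is closed in the trace of the compact
set `{r n} × 2^D`. -/
lemma isCompact_cell [T2Space A] {n : ℕ} {p q : D} (hp : c n ≤ p) (hq : q ≤ c (n + 1)) :
    IsCompact (cell p q : Set (Glued r c)) := by
  have hK : IsCompact (({r n} : Set (A ⊕ ℕ)) ×ˢ (Set.univ : Set (D → Bool))) :=
    isCompact_singleton.prod isCompact_univ
  refine (isClosedEmbedding_val.isCompact_preimage hK).of_isClosed_subset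
    (isClopen_cell p q).isClosed fun x hx => ⟨?_, trivial⟩
  exact base_eq (cut_of_le hp hx.1) (not_cut_of_le hq hx.2)

lemma exists_cell_subset {x : Glued r c} {n : ℕ} (hn : x ∈ cell (c n) (c (n + 1)))
    {U : Set (Glued r c)} (hU : IsOpen U) (hx : x ∈ U) :
    ∃ p q, c n ≤ p ∧ p ≤ q ∧ q ≤ c (n + 1) ∧ x ∈ cell p q ∧ cell p q ⊆ U := by
  obtain ⟨V, hV, rfl⟩ := isEmbedding_val.isOpen_iff.1 hU
  obtain ⟨V₁, V₂, -, hV₂, hx₁, hx₂, hVV⟩ := isOpen_prod_iff.1 hV _ _ hx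
  obtain ⟨I, u, hu, hIu⟩ := isOpen_pi_iff.1 hV₂ _ hx₂
  -- A basic neighbourhood constrains finitely many `g`; take the last one in the cut and the first
  -- one outside. Adjoining `c n` and `c (n + 1)` keeps the cell inside its block, where the base is
  -- constant.
  obtain ⟨p, hp, hpmax⟩ := Finset.exists_max_image
    ((insert (c n) I).filter fun g => x.cut g = true) id ⟨c n, by simp [hn.1]⟩
  obtain ⟨q, hq, hqmin⟩ := Finset.exists_min_image
    ((insert (c (n + 1)) I).filter fun g => x.cut g = false) id ⟨c (n + 1), by simp [hn.2]⟩
  simp only [Finset.mem_filter, Finset.mem_insert, id, and_imp] at hp hpmax hq hqmin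
  refine ⟨p, q, hpmax _ (Or.inl rfl) hn.1, (lt_of_cut hp.2 hq.2).le, hqmin _ (Or.inl rfl) hn.2,
    ⟨hp.2, hq.2⟩, fun y hy => hVV ⟨?_, hIu fun g hg => ?_⟩⟩
  · have : y.base = x.base := by
      rw [base_eq hn.1 hn.2]
      exact base_eq (cut_of_le (hpmax _ (Or.inl rfl) hn.1) hy.1)
        (not_cut_of_le (hqmin _ (Or.inl rfl) hn.2) hy.2)
    change y.base ∈ V₁
    rwa [this]
  · have : y.cut g = x.cut g := by
      cases hxg : x.cut g with
      | true => exact cut_of_le (hpmax g (Or.inr hg) hxg) hy.1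
      | false => exact not_cut_of_le (hqmin g (Or.inr hg) hxg) hy.2
    simpa [this] using (hu g hg).2

end Glued

/-! ### Gluing data and the measure they carry. -/

variable [TopologicalSpace A]

/-- The conditions under which `Glued r c` carries a good measure with values set `D`. -/
structure IsGluing (G : AddSubgroup ℝ) (a : ℝ≥0∞) (D : Set ℝ) (r : ℕ → A ⊕ ℕ) (c : ℕ → D) :
    Prop where
  eq_inter : D = (G : Set ℝ) ∩ halfOpen a
  countable : D.Countable
  dense : halfOpen a ⊆ closure D
  map_zero : (c 0 : ℝ) = 0
  strictMono : StrictMono c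
  cofinal : ∀ x : D, ∃ n, x ≤ c n
  eq_of_inr : ∀ n k, r n = Sum.inr k → k = n
  exists_inr : ∀ N, ∃ n ≥ N, r n = Sum.inr n
  recurrent : ∀ U : Set A, IsOpen U → U.Nonempty → ∃ m > 0, ∀ N, ∃ n ≥ N,
    r n ∈ Sum.inl '' U ∧ m ≤ (c (n + 1) : ℝ) - c n

namespace IsGluing

open Glued

variable {G : AddSubgroup ℝ} {a : ℝ≥0∞}

lemma exists_mem_cell (h : IsGluing G a D r c) {x : Glued r c} (hx : x ∉ topSet) :
    ∃ n, x ∈ cell (c n) (c (n + 1)) := by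
  classical
  simp only [topSet, Set.mem_ofPred_eq, not_forall, Bool.not_eq_true] at hx
  obtain ⟨g, hg⟩ := hx
  obtain ⟨N, hN⟩ := h.cofinal g
  have hex : ∃ N, x.cut (c N) = false := ⟨N, not_cut_of_le hN hg⟩
  have h1 := Nat.find_spec hex
  have h2 := fun {m} => Nat.find_min hex (m := m)
  generalize Nat.find hex = k at h1 h2
  cases k with
  | zero => simp [cut_zero] at h1
  | succ k =>
    have := h2 (Nat.lt_succ_self k)
    exact ⟨k, by simpa using this, h1⟩

/-- The point of the `n`-th Cantor set given by the cut at the real number `t`. -/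
noncomputable def point (h : IsGluing G a D r c) (n : ℕ) (t : ℝ) : Glued r c :=
  -- The bounds `c n` and `c (n + 1)` clamp `t`, so every real `t` gives a point of block `n`.
  ⟨(r n, fun g => open Classical in decide (g ≤ c n ∨ ((g : ℝ) < t ∧ g < c (n + 1)))), by
    have hm := h.strictMono.monotone
    refine ⟨?_, ?_, ?_, ?_⟩
    · intro g g' hg hg'
      simp only [decide_eq_true_eq] at hg' ⊢
      have : (g : ℝ) ≤ g' := hg
      rcases hg' with h1 | h1
      · exact Or.inl (hg.trans h1)
      · exact Or.inr ⟨this.trans_lt h1.1, hg.trans_lt h1.2⟩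
    · simp [hm (Nat.zero_le n)]
    · intro k hk hk'
      simp only [decide_eq_true_eq, decide_eq_false_iff_not, not_or, not_le] at hk hk'
      have h1 : k < n + 1 := by
        rcases hk with h1 | h1
        · exact (h.strictMono.le_iff_le.1 h1).trans_lt (Nat.lt_succ_self n)
        · exact h.strictMono.lt_iff_lt.1 h1.2
      have h2 := h.strictMono.lt_iff_lt.1 hk'.1
      obtain rfl : n = k := by omega
      rfl
    · intro k hk
      obtain rfl := h.eq_of_inr _ _ hk
      simp [h.strictMono (Nat.lt_succ_self k)]⟩

lemma base_point (h : IsGluing G a D r c) (n : ℕ) (t : ℝ) : (h.point n t).base = r n := rfl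

lemma cut_point (h : IsGluing G a D r c) (n : ℕ) (t : ℝ) (g : D) :
    (h.point n t).cut g = true ↔ g ≤ c n ∨ ((g : ℝ) < t ∧ g < c (n + 1)) := by
  simp [point, cut]

lemma cut_point' (h : IsGluing G a D r c) (n : ℕ) (t : ℝ) (g : D) :
    (h.point n t).cut g = false ↔ c n < g ∧ (t ≤ g ∨ c (n + 1) ≤ g) := by
  rw [← Bool.not_eq_true, cut_point]
  push Not
  rw [imp_iff_not_or, not_lt]

lemma point_mem_cell (h : IsGluing G a D r c) (n : ℕ) (t : ℝ) :
    h.point n t ∈ cell (c n) (c (n + 1)) := by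
  constructor
  · rw [cut_point]; simp
  · rw [cut_point']; simp [h.strictMono (Nat.lt_succ_self n)]

/-- As `D` is countable, the Borel sets of `D → Bool` are generated by the coordinates, so it
suffices to check each `g`. -/
lemma measurable_point (h : IsGluing G a D r c) (n : ℕ) : Measurable (h.point n) := by
  have : Countable D := h.countable
  refine measurable_of_isOpen fun U hU => ?_
  obtain ⟨V, hV, rfl⟩ := isEmbedding_val.isOpen_iff.1 hU
  have hm : Measurable fun t => (h.point n t).cut := by
    refine measurable_pi_iff.2 fun g => measurable_to_bool ?_
    have : (fun t => (h.point n t).cut g) ⁻¹' {true} =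
        {t | g ≤ c n} ∪ {t | (g : ℝ) < t ∧ g < c (n + 1)} := by
      ext t
      exact cut_point h n t g
    rw [this]
    exact (MeasurableSet.const _).union (measurableSet_Ioi.inter (MeasurableSet.const _))
  have hV' : IsOpen {L : D → Bool | (r n, L) ∈ V} :=
    hV.preimage (continuous_const.prodMk continuous_id)
  exact hm hV'.measurableSet

/-- The image of Lebesgue measure on `[0, a)`. -/
noncomputable def measure (h : IsGluing G a D r c) : Measure (Glued r c) :=
  Measure.sum fun n => (volume.restrict (Set.Ioc (c n : ℝ) (c (n + 1)))).map (h.point n)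

lemma measure_apply (h : IsGluing G a D r c) {s : Set (Glued r c)} (hs : MeasurableSet s) :
    h.measure s = ∑' n, volume (h.point n ⁻¹' s ∩ Set.Ioc (c n : ℝ) (c (n + 1))) := by
  rw [measure, Measure.sum_apply _ hs]
  congr with n
  rw [Measure.map_apply (h.measurable_point n) hs,
    Measure.restrict_apply (h.measurable_point n hs)]

lemma measure_cell (h : IsGluing G a D r c) {n : ℕ} {p q : D} (hp : c n ≤ p) (hpq : p ≤ q)
    (hq : q ≤ c (n + 1)) : h.measure (cell p q) = ENNReal.ofReal (q - p) := by
  rcases hpq.eq_or_lt with rfl | hlt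
  · simp [cell_self]
  have hm := h.strictMono.monotone
  rw [h.measure_apply (isClopen_cell p q).isOpen.measurableSet, tsum_eq_single n, ← Real.volume_Ioc]
  · congr 1
    ext t
    simp only [cell, Set.mem_inter_iff, Set.mem_preimage, Set.mem_ofPred_eq, cut_point, cut_point',
      Set.mem_Ioc]
    simp only [← Subtype.coe_le_coe, ← Subtype.coe_lt_coe] at *
    constructor
    · rintro ⟨⟨h1, h2, h3⟩, h4, h5⟩
      constructor
      · rcases h1 with h1 | h1 <;> linarith
      · rcases h3 with h3 | h3 <;> linarith
    · rintro ⟨h1, h2⟩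
      exact ⟨⟨Or.inr ⟨h1, by linarith⟩, by linarith, Or.inl h2⟩, by linarith, by linarith⟩
  · intro k hk
    convert measure_empty (μ := volume)
    refine Set.eq_empty_of_forall_notMem ?_
    rintro t ⟨⟨h1, h2⟩, h3⟩
    rw [cut_point] at h1
    rw [cut_point'] at h2
    rcases lt_or_gt_of_ne hk with hlt' | hlt'
    · have h4 : c (k + 1) ≤ p := (hm hlt').trans hp
      have h5 := h.strictMono (Nat.lt_succ_self k)
      rcases h1 with h1 | h1
      · exact absurd (h5.trans_le h4) h1.not_gt
      · exact absurd h4 h1.2.not_ge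
    · exact absurd (hq.trans (hm hlt')) h2.1.not_ge

lemma measure_topSet (h : IsGluing G a D r c) : h.measure topSet = 0 := by
  have e : (topSet : Set (Glued r c)) = ⋂ g, {x | x.cut g = true} := by
    ext x; simp [topSet]
  have hm : MeasurableSet (topSet : Set (Glued r c)) := by
    rw [e]
    exact (isClosed_iInter fun g => (isClopen_cut g true).isClosed).measurableSet
  rw [h.measure_apply hm, ENNReal.tsum_eq_zero]
  intro n
  convert measure_empty (μ := volume)
  refine Set.eq_empty_of_forall_notMem ?_
  rintro t ⟨h1, -⟩
  have := (h.point_mem_cell n t).2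
  simp [h1 (c (n + 1))] at this

lemma measure_univ (h : IsGluing G a D r c) : h.measure Set.univ = a := by
  have e : h.measure Set.univ = ⨆ N, ENNReal.ofReal (c N) := by
    simp only [h.measure_apply MeasurableSet.univ, Set.preimage_univ, Set.univ_inter,
      Real.volume_Ioc]
    rw [ENNReal.tsum_eq_iSup_nat]
    congr with N
    rw [← ENNReal.ofReal_sum_of_nonneg, Finset.sum_range_sub (fun n => (c n : ℝ)), h.map_zero,
      sub_zero]
    intro n _
    have : (c n : ℝ) ≤ c (n + 1) := (h.strictMono (Nat.lt_succ_self n)).le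
    linarith
  have hD : ∀ g : D, (g : ℝ) ∈ halfOpen a := fun g => (h.eq_inter.subset g.2).2
  rw [e]
  refine le_antisymm (iSup_le fun N => (hD (c N)).2.le) (le_of_forall_lt fun b hb => ?_)
  obtain ⟨y, hby, hya⟩ := ENNReal.lt_iff_exists_nnreal_btwn.1 hb
  obtain ⟨z, hyz, hza⟩ := ENNReal.lt_iff_exists_nnreal_btwn.1 hya
  have hz : (z : ℝ) ∈ halfOpen a := ⟨z.2, by simpa using hza⟩
  have hyz' : (0 : ℝ) < z - y := by
    have : (y : ℝ) < z := by exact_mod_cast hyz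
    linarith
  obtain ⟨d, hd, hdz⟩ := Metric.mem_closure_iff.1 (h.dense hz) _ hyz'
  rw [Real.dist_eq, abs_lt] at hdz
  obtain ⟨N, hN⟩ := h.cofinal ⟨d, hd⟩
  have hN' : d ≤ c N := hN
  refine hby.trans (lt_iSup_iff.2 ⟨N, ?_⟩)
  rw [ENNReal.lt_ofReal_iff_toReal_lt (by simp)]
  simp only [ENNReal.coe_toReal]
  linarith

/-- By density some element of `D` separates any two reals of a block, so each block meets the fibre
of `x` in at most one real. -/
lemma measure_singleton (h : IsGluing G a D r c) [T2Space A] (x : Glued r c) :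
    h.measure {x} = 0 := by
  have : T2Space (Glued r c) := isEmbedding_val.t2Space
  rw [h.measure_apply (measurableSet_singleton x), ENNReal.tsum_eq_zero]
  intro n
  refine Set.Subsingleton.measure_zero ?_ _
  have key : ∀ t t', t < t' → t' ∈ Set.Ioc (c n : ℝ) (c (n + 1)) →
      t ∈ Set.Ioc (c n : ℝ) (c (n + 1)) → h.point n t = x → h.point n t' = x → False := by
    intro t t' htt' ht' ht hx hx'
    have hmid : (t + t') / 2 ∈ halfOpen a := by
      have h0 : (0 : ℝ) ≤ c n := (h.eq_inter.subset (c n).2).2.1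
      exact mem_halfOpen_of_le (by linarith [ht.1]) (by linarith [ht'.2])
        (h.eq_inter.subset (c (n + 1)).2).2
    obtain ⟨d, hd, hdz⟩ := Metric.mem_closure_iff.1 (h.dense hmid) ((t' - t) / 2) (by linarith)
    rw [Real.dist_eq, abs_lt] at hdz
    have h1 : (h.point n t').cut ⟨d, hd⟩ = true := by
      rw [cut_point]
      right
      rw [← Subtype.coe_lt_coe]
      exact ⟨by simp only; linarith, by simp only; linarith [ht'.2]⟩
    have h2 : (h.point n t).cut ⟨d, hd⟩ = false := by
      rw [cut_point', ← Subtype.coe_lt_coe]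
      exact ⟨by simp only; linarith [ht.1], Or.inl (by simp only; linarith)⟩
    rw [hx] at h2
    rw [hx', h2] at h1
    cases h1
  rintro t ⟨h1, h2⟩ t' ⟨h1', h2'⟩
  rcases lt_trichotomy t t' with hlt | heq | hlt
  · exact (key t t' hlt h2' h2 h1 h1').elim
  · exact heq
  · exact (key t' t hlt h2 h2' h1' h1).elim

/-- A neighbourhood of a top point restricts the base to an open set of labels and finitely many `g`
to lie in the cut. Any block beyond those `g` with an allowed label lies entirely inside. -/
lemma exists_cell_subset_of_mem_topSet (h : IsGluing G a D r c) {x : Glued r c}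
    (hx : x ∈ topSet) {U : Set (Glued r c)} (hU : IsOpen U) (hxU : x ∈ U) :
    ∃ m > 0, ∀ N, ∃ n ≥ N, cell (c n) (c (n + 1)) ⊆ U ∧ m ≤ (c (n + 1) : ℝ) - c n := by
  obtain ⟨α, hα⟩ := base_of_mem_topSet hx
  obtain ⟨V, hV, rfl⟩ := isEmbedding_val.isOpen_iff.1 hU
  obtain ⟨V₁, V₂, hV₁, hV₂, hx₁, hx₂, hVV⟩ := isOpen_prod_iff.1 hV _ _ hxU
  obtain ⟨I, u, hu, hIu⟩ := isOpen_pi_iff.1 hV₂ _ hx₂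
  obtain ⟨m, hm, hrec⟩ := h.recurrent (Sum.inl ⁻¹' V₁) (hV₁.preimage continuous_inl)
    ⟨α, by simpa [hα] using hx₁⟩
  have hI : ∃ M, ∀ g ∈ I, g ≤ c M := by
    choose f hf using h.cofinal
    exact ⟨I.sup f, fun g hg => (hf g).trans (h.strictMono.monotone (Finset.le_sup hg))⟩
  obtain ⟨M, hM⟩ := hI
  refine ⟨m, hm, fun N => ?_⟩
  obtain ⟨n, hn, ⟨β, hβ, hβn⟩, hmn⟩ := hrec (max N M)
  refine ⟨n, (le_max_left _ _).trans hn, fun y hy => hVV ⟨?_, hIu fun g hg => ?_⟩, hmn⟩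
  · change y.base ∈ V₁
    rw [base_eq hy.1 hy.2, ← hβn]
    exact hβ
  · have h1 : y.cut g = true :=
      cut_of_le ((hM g hg).trans (h.strictMono.monotone ((le_max_right _ _).trans hn))) hy.1
    have h2 := (hu g hg).2
    rw [hx g] at h2
    simpa [h1] using h2

lemma measure_eq_top (h : IsGluing G a D r c) {x : Glued r c} (hx : x ∈ topSet)
    {U : Set (Glued r c)} (hU : IsOpen U) (hxU : x ∈ U) : h.measure U = ∞ := by
  obtain ⟨m, hm, hrec⟩ := h.exists_cell_subset_of_mem_topSet hx hU hxU
  by_contra hne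
  rw [h.measure_apply hU.measurableSet] at hne
  have hlim := ENNReal.tendsto_atTop_zero_of_tsum_ne_top hne
  obtain ⟨N, hN⟩ := Filter.eventually_atTop.1
    (hlim.eventually_lt_const (ENNReal.ofReal_pos.2 hm))
  obtain ⟨n, hn, hsub, hmn⟩ := hrec N
  refine (hN n hn).not_ge ?_
  have : h.point n ⁻¹' U = Set.univ :=
    Set.eq_univ_of_forall fun t => hsub (h.point_mem_cell n t)
  rw [this, Set.univ_inter, Real.volume_Ioc]
  exact ENNReal.ofReal_le_ofReal hmn

lemma measure_pos (h : IsGluing G a D r c) {U : Set (Glued r c)} (hU : IsOpen U)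
    (hne : U.Nonempty) : 0 < h.measure U := by
  obtain ⟨x, hx⟩ := hne
  by_cases hxt : x ∈ topSet
  · simp [h.measure_eq_top hxt hU hx]
  · obtain ⟨n, hn⟩ := h.exists_mem_cell hxt
    obtain ⟨p, q, hp, hpq, hq, hxpq, hsub⟩ := exists_cell_subset hn hU hx
    refine lt_of_lt_of_le ?_ (measure_mono hsub)
    rw [h.measure_cell hp hpq hq, ENNReal.ofReal_pos, sub_pos]
    exact lt_of_cut hxpq.1 hxpq.2

lemma exists_lt_measure_inter (h : IsGluing G a D r c) {V : Set (Glued r c)} {b : ℝ≥0∞}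
    (hb : b < h.measure V) : ∃ N, b < h.measure (V ∩ {x | x.cut (c N) = false}) := by
  have hmono : Monotone fun N => V ∩ {x : Glued r c | x.cut (c N) = false} := fun N M hNM x hx =>
    ⟨hx.1, not_cut_of_le (h.strictMono.monotone hNM) hx.2⟩
  have e : h.measure V ≤ ⨆ N, h.measure (V ∩ {x | x.cut (c N) = false}) := by
    rw [← hmono.measure_iUnion]
    calc h.measure V ≤ h.measure ((⋃ N, V ∩ {x | x.cut (c N) = false}) ∪ topSet) := by
          refine measure_mono fun x hx => ?_
          by_cases hxt : x ∈ topSet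
          · exact Or.inr hxt
          · obtain ⟨n, hn⟩ := h.exists_mem_cell hxt
            exact Or.inl (Set.mem_iUnion.2 ⟨n + 1, hx, hn.2⟩)
      _ ≤ _ := by
          refine (measure_union_le _ _).trans ?_
          rw [h.measure_topSet, add_zero]
  exact lt_iSup_iff.1 (hb.trans_le e)

lemma defectiveSet_eq (h : IsGluing G a D r c) [T2Space A] :
    defectiveSet h.measure = topSet := by
  ext x
  constructor
  · intro hx
    by_contra hxt
    obtain ⟨n, hn⟩ := h.exists_mem_cell hxt
    have := hx _ (isCompact_cell le_rfl le_rfl) (isClopen_cell _ _).isOpen hn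
    rw [h.measure_cell le_rfl (h.strictMono (Nat.lt_succ_self n)).le le_rfl] at this
    exact ENNReal.ofReal_ne_top this
  · intro hx U _ hU hxU
    exact h.measure_eq_top hx hU hxU

lemma memMZero (h : IsGluing G a D r c) [T2Space A] : MemMZero h.measure := by
  refine ⟨fun U hU hne => h.measure_pos hU hne, h.measure_singleton, ?_⟩
  rw [IsNondefective, h.defectiveSet_eq, h.measure_univ, h.measure_topSet]
  simpa using (le_top (a := a)).lt_or_eq

/-- A compact space would project onto finitely many labels in `ℕ`. -/
lemma noncompactSpace (h : IsGluing G a D r c) : NoncompactSpace (Glued r c) := by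
  refine ⟨fun hc => ?_⟩
  have h1 := Topology.IsClosedEmbedding.inr.isCompact_preimage (hc.image continuous_base)
  obtain ⟨N, hN⟩ := (isCompact_iff_finite.1 h1).bddAbove
  obtain ⟨n, hn, hrn⟩ := h.exists_inr (N + 1)
  have : n ≤ N := hN ⟨h.point n 0, trivial, (h.base_point n 0).trans hrn⟩
  omega

lemma isNoncompactLCCantor (h : IsGluing G a D r c) [T2Space A] [SecondCountableTopology A]
    [LocallyCompactSpace A] [TotallyDisconnectedSpace A] : IsNoncompactLCCantor (Glued r c) := by
  have : Countable D := h.countable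
  have := locallyCompactSpace_sum A ℕ
  have : T2Space (Glued r c) := isEmbedding_val.t2Space
  have : SecondCountableTopology (Glued r c) := isEmbedding_val.secondCountableTopology
  have : LocallyCompactSpace (Glued r c) := isClosedEmbedding_val.locallyCompactSpace
  have : TotallyDisconnectedSpace (Glued r c) :=
    inferInstanceAs (TotallyDisconnectedSpace (gluedSet r c))
  refine ⟨inferInstance, inferInstance, h.noncompactSpace, fun x hx => ?_, ?_⟩
  · exact (h.measure_pos hx ⟨x, rfl⟩).ne' (h.measure_singleton x)
  · have hb : IsTopologicalBasis {U : Set (Glued r c) | IsCompact U ∧ IsOpen U} := by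
      refine isTopologicalBasis_of_isOpen_of_nhds (fun U hU => hU.2) fun x U hxU hU => ?_
      obtain ⟨K, hK, hxK, hKU⟩ := exists_compact_subset hU hxU
      obtain ⟨V, hV, hxV, hVK⟩ := (loc_compact_Haus_tot_disc_of_zero_dim
        (H := Glued r c)).exists_subset_of_mem_open hxK isOpen_interior
      exact ⟨V, ⟨hK.of_isClosed_subset hV.isClosed (hVK.trans interior_subset), hV.isOpen⟩, hxV,
        hVK.trans (interior_subset.trans hKU)⟩
    obtain ⟨B, hB, hBc, hBb⟩ := hb.exists_countable
    exact ⟨B, hBc, hBb, fun U hU => hB hU⟩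

end IsGluing

end

/-- The compact open set `V` has measure in `G`, and all smaller non-negative elements of `G` are
measures of compact open subsets of `V`. -/
structure IsDivisible {X : Type*} [TopologicalSpace X] [MeasurableSpace X] (G : AddSubgroup ℝ)
    (μ : Measure X) (V : Set X) : Prop where
  isCompact : IsCompact V
  isOpen : IsOpen V
  exists_value : ∃ v ∈ G, 0 ≤ v ∧ μ V = ENNReal.ofReal v ∧
    ∀ s ∈ G, 0 ≤ s → s ≤ v → ∃ W, IsCompact W ∧ IsOpen W ∧ W ⊆ V ∧ μ W = ENNReal.ofReal s

lemma IsDivisible.union {X : Type*} [TopologicalSpace X] [T2Space X] [MeasurableSpace X]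
    [BorelSpace X] {G : AddSubgroup ℝ} {μ : Measure X} {V V' : Set X} (h : IsDivisible G μ V)
    (h' : IsDivisible G μ V') (hd : Disjoint V V') : IsDivisible G μ (V ∪ V') := by
  obtain ⟨v, hv, hv0, hμ, hW⟩ := h.exists_value
  obtain ⟨v', hv', hv0', hμ', hW'⟩ := h'.exists_value
  refine ⟨h.isCompact.union h'.isCompact, h.isOpen.union h'.isOpen, v + v', add_mem hv hv',
    by positivity, ?_, fun s hs hs0 hsv => ?_⟩
  · rw [measure_union hd h'.isOpen.measurableSet, hμ, hμ', ENNReal.ofReal_add hv0 hv0']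
  · rcases le_total s v with hle | hle
    · obtain ⟨W, h1, h2, h3, h4⟩ := hW s hs hs0 hle
      exact ⟨W, h1, h2, h3.trans Set.subset_union_left, h4⟩
    · obtain ⟨W, h1, h2, h3, h4⟩ := hW' (s - v) (sub_mem hs hv) (by linarith) (by linarith)
      refine ⟨V ∪ W, h.isCompact.union h1, h.isOpen.union h2, Set.union_subset_union_right _ h3, ?_⟩
      rw [measure_union (hd.mono_right h3) h2.measurableSet, hμ, h4,
        ← ENNReal.ofReal_add hv0 (by linarith), add_sub_cancel]

lemma isDivisible_empty {X : Type*} [TopologicalSpace X] [MeasurableSpace X] (G : AddSubgroup ℝ)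
    (μ : Measure X) : IsDivisible G μ ∅ := by
  refine ⟨isCompact_empty, isOpen_empty, 0, zero_mem G, le_rfl, by simp, fun s hs hs0 hs0' => ?_⟩
  obtain rfl : s = 0 := le_antisymm hs0' hs0
  exact ⟨∅, isCompact_empty, isOpen_empty, subset_rfl, by simp⟩

/-! ### Divisibility of compact open sets, goodness and the value set. -/

namespace IsGluing

open Glued

variable {A : Type*} [TopologicalSpace A] [T2Space A] {D : Set ℝ} {r : ℕ → A ⊕ ℕ} {c : ℕ → D}
  {G : AddSubgroup ℝ} {a : ℝ≥0∞}

lemma isDivisible_cell (h : IsGluing G a D r c) {n : ℕ} {p q : D} (hp : c n ≤ p) (hpq : p ≤ q)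
    (hq : q ≤ c (n + 1)) : IsDivisible G h.measure (cell p q) := by
  have hD := h.eq_inter.subset
  refine ⟨isCompact_cell hp hq, (isClopen_cell p q).isOpen, q - p,
    sub_mem (hD q.2).1 (hD p.2).1, sub_nonneg.2 hpq, h.measure_cell hp hpq hq,
    fun s hs hs0 hsv => ?_⟩
  -- This is where `D = G ∩ [0, a)` matters: the cut point `p + s` is again a legitimate endpoint.
  have hps : (p : ℝ) + s ∈ D := h.eq_inter.superset
    ⟨add_mem (hD p.2).1 hs, mem_halfOpen_of_le (add_nonneg (hD p.2).2.1 hs0) (by linarith)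
      (hD q.2).2⟩
  have h1 : p ≤ ⟨p + s, hps⟩ := by rw [← Subtype.coe_le_coe]; simpa using hs0
  have h2 : ⟨p + s, hps⟩ ≤ q := by rw [← Subtype.coe_le_coe]; simp only; linarith
  refine ⟨cell p ⟨p + s, hps⟩, isCompact_cell hp (h2.trans hq), (isClopen_cell _ _).isOpen,
    fun x hx => ⟨hx.1, not_cut_of_le h2 hx.2⟩, ?_⟩
  rw [h.measure_cell hp h1 (h2.trans hq)]
  simp

/-- The cells contained in one of the Cantor sets between `c n` and `c (n + 1)`. -/
def smallCells (r : ℕ → A ⊕ ℕ) (c : ℕ → D) : Set (Set (Glued r c)) :=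
  {V | ∃ n p q, c n ≤ p ∧ p ≤ q ∧ q ≤ c (n + 1) ∧ V = cell p q}

/-- Removing one cell leaves two disjoint small cells, to which the induction hypothesis applies;
hence `V` must vary in the induction. -/
lemma isDivisible_sdiff_sUnion (h : IsGluing G a D r c) {S : Set (Set (Glued r c))}
    (hS : S.Finite) (hSc : S ⊆ smallCells r c) :
    ∀ V ∈ smallCells r c, IsDivisible G h.measure (V \ ⋃₀ S) := by
  have : T2Space (Glued r c) := isEmbedding_val.t2Space
  induction S, hS using Set.Finite.induction_on with
  | empty =>
    rintro _ ⟨n, p, q, hp, hpq, hq, rfl⟩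
    simpa using h.isDivisible_cell hp hpq hq
  | @insert J S _ _ ih =>
    rintro _ ⟨n, p, q, hp, hpq, hq, rfl⟩
    have ih := ih ((Set.subset_insert _ _).trans hSc)
    obtain ⟨m, p', q', -, hpq', -, rfl⟩ := hSc (Set.mem_insert J S)
    have h1 : max p (min q p') ≤ q := max_le hpq (min_le_left _ _)
    have h2 : max p (min q q') ≤ q := max_le hpq (min_le_left _ _)
    have h3 : max p (min q p') ≤ max p (min q q') := max_le_max le_rfl (min_le_min le_rfl hpq')
    rw [Set.sUnion_insert, ← Set.sdiff_sdiff, cell_sdiff_cell p q p' q' hpq,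
      Set.union_sdiff_distrib]
    refine (ih _ ⟨n, _, _, hp, le_max_left _ _, h1.trans hq, rfl⟩).union
      (ih _ ⟨n, _, _, hp.trans (le_max_left _ _), h2, hq, rfl⟩) ?_
    refine Set.disjoint_left.2 fun x hx hx' => ?_
    exact (lt_of_cut hx'.1.1 hx.1.2).not_ge h3

lemma isDivisible_sUnion (h : IsGluing G a D r c) {S : Set (Set (Glued r c))}
    (hS : S.Finite) (hSc : S ⊆ smallCells r c) : IsDivisible G h.measure (⋃₀ S) := by
  have : T2Space (Glued r c) := isEmbedding_val.t2Space
  induction S, hS using Set.Finite.induction_on with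
  | empty => simpa using isDivisible_empty G h.measure
  | @insert J S _ hS ih =>
    have hSc' := (Set.subset_insert _ _).trans hSc
    rw [Set.sUnion_insert, Set.union_comm, ← Set.union_sdiff_self]
    exact (ih hSc').union (h.isDivisible_sdiff_sUnion hS hSc' J (hSc (Set.mem_insert J S)))
      Set.disjoint_sdiff_right

lemma isDivisible_of_disjoint (h : IsGluing G a D r c) {V : Set (Glued r c)} (hVc : IsCompact V)
    (hVo : IsOpen V) (hV : Disjoint V topSet) : IsDivisible G h.measure V := by
  have hex : ∀ x ∈ V, ∃ C ∈ smallCells r c, x ∈ C ∧ C ⊆ V := by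
    intro x hx
    obtain ⟨n, hn⟩ := h.exists_mem_cell (Set.disjoint_left.1 hV hx)
    obtain ⟨p, q, hp, hpq, hq, hxpq, hsub⟩ := exists_cell_subset hn hVo hx
    exact ⟨_, ⟨n, p, q, hp, hpq, hq, rfl⟩, hxpq, hsub⟩
  choose! C hC hxC hCV using hex
  obtain ⟨t, ht, hVt⟩ := hVc.elim_nhds_subcover C fun x hx => by
    obtain ⟨n, p, q, -, -, -, e⟩ := hC x hx
    have := hxC x hx
    rw [e] at this ⊢
    exact (isClopen_cell p q).isOpen.mem_nhds this
  have e : V = ⋃₀ (C '' t) := by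
    rw [Set.sUnion_image]
    exact Set.Subset.antisymm hVt (Set.iUnion₂_subset fun x hx => hCV x (ht x hx))
  rw [e]
  refine h.isDivisible_sUnion (t.finite_toSet.image C) ?_
  rintro _ ⟨x, hx, rfl⟩
  exact hC x (ht x hx)

lemma isDivisible_of_measure_lt_top (h : IsGluing G a D r c) {V : Set (Glued r c)}
    (hVc : IsCompact V) (hVo : IsOpen V) (hV : h.measure V < ∞) : IsDivisible G h.measure V :=
  h.isDivisible_of_disjoint hVc hVo
    (Set.disjoint_left.2 fun _ hx hxt => hV.ne (h.measure_eq_top hxt hVo hx))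

/-- The part of a compact open set below `c N` misses `topSet`, so it is divisible. -/
lemma isDivisible_inter (h : IsGluing G a D r c) {V : Set (Glued r c)}
    (hVc : IsCompact V) (hVo : IsOpen V) (N : ℕ) :
    IsDivisible G h.measure (V ∩ {x | x.cut (c N) = false}) := by
  refine h.isDivisible_of_disjoint (hVc.inter_right (isClopen_cut _ _).isClosed)
    (hVo.inter (isClopen_cut _ _).isOpen) (Set.disjoint_left.2 fun x hx hxt => ?_)
  have := hx.2
  simp [hxt (c N)] at this

/-- `V` may have infinite measure; some truncation of it already exceeds `μ U` and is divisible. -/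
theorem isGood (h : IsGluing G a D r c) : IsGood h.measure := by
  intro V hVc hVo U hUc hUo hUV
  obtain ⟨u, hu, hu0, hμu, -⟩ :=
    (h.isDivisible_of_measure_lt_top hUc hUo (hUV.trans_le le_top)).exists_value
  obtain ⟨N, hN⟩ := h.exists_lt_measure_inter hUV
  obtain ⟨v, hv, hv0, hμv, hW⟩ := (h.isDivisible_inter hVc hVo N).exists_value
  rw [hμu, hμv] at hN
  obtain ⟨W, h1, h2, h3, h4⟩ := hW u hu hu0 (ENNReal.lt_ofReal_iff_toReal_lt (by simp) |>.1 hN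
    |>.le.trans' (by rw [ENNReal.toReal_ofReal hu0]))
  exact ⟨W, h1, h2, h3.trans Set.inter_subset_left, h4.trans hμu.symm⟩

theorem compactOpenValues_eq (h : IsGluing G a D r c) : compactOpenValues h.measure = D := by
  have : T2Space (Glued r c) := isEmbedding_val.t2Space
  have := h.noncompactSpace
  apply Set.Subset.antisymm
  · rintro _ ⟨U, hUc, hUo, hU, rfl⟩
    obtain ⟨u, hu, hu0, hμu, -⟩ := (h.isDivisible_of_measure_lt_top hUc hUo hU).exists_value
    refine h.eq_inter.superset ?_
    rw [hμu, ENNReal.toReal_ofReal hu0]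
    exact ⟨hu, hu0, hμu ▸ (h.memMZero.measure_lt_univ hUc hU).trans_eq h.measure_univ⟩
  · intro d hd
    have hdG := h.eq_inter.subset hd
    obtain ⟨N, hN⟩ := h.exists_lt_measure_inter (V := Set.univ)
      (hdG.2.2.trans_eq h.measure_univ.symm)
    have hfin : {C | ∃ n < N, C = (cell (c n) (c (n + 1)) : Set (Glued r c))}.Finite :=
      ((Set.finite_lt_nat N).image fun n => (cell (c n) (c (n + 1)) : Set (Glued r c))).subset <| by
        rintro _ ⟨n, hn, rfl⟩
        exact ⟨n, hn, rfl⟩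
    have hdiv := h.isDivisible_sUnion hfin <| by
      rintro _ ⟨n, -, rfl⟩
      exact ⟨n, _, _, le_rfl, (h.strictMono (Nat.lt_succ_self n)).le, le_rfl, rfl⟩
    obtain ⟨v, hv, hv0, hμv, hW⟩ := hdiv.exists_value
    have hdv : ENNReal.ofReal d < ENNReal.ofReal v := by
      rw [← hμv]
      refine hN.trans_le (measure_mono fun x hx => ?_)
      have hx2 : x.cut (c N) = false := hx.2
      obtain ⟨n, hn⟩ := h.exists_mem_cell (x := x) fun hxt => by simp [hxt (c N)] at hx2
      exact ⟨_, ⟨n, h.strictMono.lt_iff_lt.1 (lt_of_cut hn.1 hx2), rfl⟩, hn⟩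
    obtain ⟨W, h1, h2, -, h4⟩ := hW d hdG.1 hdG.2.1 (ENNReal.ofReal_lt_ofReal_iff'.1 hdv).1.le
    exact mem_compactOpenValues hdG.2.1 h1 h2 h4

lemma nonempty_homeomorph (h : IsGluing G a D r c) :
    Nonempty (defectiveSet h.measure ≃ₜ A) := by
  rw [h.defectiveSet_eq, ← range_ofTop]
  exact ⟨isEmbedding_ofTop.toHomeomorph.symm⟩

end IsGluing

/-- Every strictly increasing cofinal sequence in a group-like set starting at `0` arises from a
gluing along any sequence `r` satisfying the conditions on the base. -/
lemma IsGroupLike.exists_isGluing {A : Type*} [TopologicalSpace A] {D : Set ℝ} {a : ℝ≥0∞}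
    (hD : IsGroupLike D a) {r : ℕ → A ⊕ ℕ} {c : ℕ → D} (h0 : (c 0 : ℝ) = 0) (hc : StrictMono c)
    (hcof : ∀ x : D, ∃ n, x ≤ c n) (hr : ∀ n k, r n = Sum.inr k → k = n)
    (hr' : ∀ N, ∃ n ≥ N, r n = Sum.inr n)
    (hrec : ∀ U : Set A, IsOpen U → U.Nonempty → ∃ m > 0, ∀ N, ∃ n ≥ N,
      r n ∈ Sum.inl '' U ∧ m ≤ (c (n + 1) : ℝ) - c n) :
    ∃ G, IsGluing G a D r c := by
  obtain ⟨G, hG⟩ := hD.exists_subgroup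
  exact ⟨G, hG, hD.countable, hD.dense, h0, hc, hcof, hr, hr', hrec⟩

/-! ### Choice of the gluing data. -/

lemma IsGroupLike.zero_mem {D : Set ℝ} {a : ℝ≥0∞} (hD : IsGroupLike D a) : (0 : ℝ) ∈ D := by
  obtain ⟨G, hG⟩ := hD.exists_subgroup
  exact hG ▸ ⟨G.zero_mem, le_rfl, by simpa using hD.pos⟩

lemma IsGroupLike.exists_cofinal {D : Set ℝ} (hD : IsGroupLike D 1) :
    ∃ c : ℕ → D, (c 0 : ℝ) = 0 ∧ StrictMono c ∧ ∀ x : D, ∃ n, x ≤ c n := by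
  have hlt : ∀ d : D, (d : ℝ) < 1 := fun d => by simpa using (hD.subset d.2).2
  have hnext : ∀ (n : ℕ) (d : D), ∃ e : D, d < e ∧ 1 - 1 / ((n : ℝ) + 1) < e := by
    intro n d
    have hd0 := (hD.subset d.2).1
    have hn : 0 < 1 / ((n : ℝ) + 1) := by positivity
    have hn' : 1 / ((n : ℝ) + 1) ≤ 1 := by
      rw [div_le_one (by positivity)]; linarith [n.cast_nonneg (α := ℝ)]
    obtain ⟨y, hy1, hy2⟩ := exists_between
      (max_lt (hlt d) (show 1 - 1 / ((n : ℝ) + 1) < 1 by linarith))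
    have hyd := (le_max_left _ _).trans_lt hy1
    have hyn := (le_max_right _ _).trans_lt hy1
    have hy : y ∈ closure D := hD.dense ⟨by linarith, by simpa using hy2⟩
    obtain ⟨e, he, hye⟩ := Metric.mem_closure_iff.1 hy (min (y - d) (y - (1 - 1 / ((n : ℝ) + 1))))
      (lt_min (by linarith) (by linarith))
    rw [Real.dist_eq, lt_min_iff, abs_lt, abs_lt] at hye
    exact ⟨⟨e, he⟩, by rw [← Subtype.coe_lt_coe]; simp only; linarith, by simp only; linarith⟩
  choose f hf1 hf2 using hnext
  refine ⟨fun n => Nat.rec ⟨0, hD.zero_mem⟩ f n, rfl, strictMono_nat_of_lt_succ fun n => hf1 _ _,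
    fun x => ?_⟩
  obtain ⟨n, hn⟩ := exists_nat_one_div_lt (sub_pos.2 (hlt x))
  refine ⟨n + 1, ?_⟩
  have := hf2 n (Nat.rec ⟨0, hD.zero_mem⟩ f n)
  rw [← Subtype.coe_le_coe]
  simp only
  linarith

/-- Equal steps give all blocks length `t`, the uniform lower bound that makes the points at
infinity defective. -/
lemma IsGroupLike.exists_arithmetic {D : Set ℝ} (hD : IsGroupLike D ∞) :
    ∃ t > 0, ∃ c : ℕ → D, ∀ n, (c n : ℝ) = n * t := by
  have h1 : (1 : ℝ) ∈ closure D := hD.dense ⟨zero_le_one, ENNReal.ofReal_lt_top⟩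
  obtain ⟨t, ht, ht1⟩ := Metric.mem_closure_iff.1 h1 1 one_pos
  rw [Real.dist_eq, abs_lt] at ht1
  have ht0 : 0 < t := by linarith
  obtain ⟨G, hG⟩ := hD.exists_subgroup
  have hmem : ∀ n : ℕ, (n : ℝ) * t ∈ D := fun n => hG.superset
    ⟨by simpa using G.nsmul_mem (hG.subset ht).1 n, by positivity, ENNReal.ofReal_lt_top⟩
  exact ⟨t, ht0, fun n => ⟨_, hmem n⟩, fun n => rfl⟩

/-- A sequence in `A ⊕ ℕ` that is frequently in every non-empty open subset of `A` and frequently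
escapes to infinity. -/
lemma exists_base_sequence (A : Type*) [TopologicalSpace A] [SeparableSpace A] :
    ∃ r : ℕ → A ⊕ ℕ, (∀ n k, r n = Sum.inr k → k = n) ∧ (∀ N, ∃ n ≥ N, r n = Sum.inr n) ∧
      ∀ U : Set A, IsOpen U → U.Nonempty → ∀ N, ∃ n ≥ N, r n ∈ Sum.inl '' U := by
  rcases isEmpty_or_nonempty A with hA | hA
  · exact ⟨Sum.inr, fun n k h => (Sum.inr.inj h).symm, fun N => ⟨N, le_rfl, rfl⟩,
      fun U _ hU => (hA.false hU.some).elim⟩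
  -- Even indices visit each term of a dense sequence infinitely often, by unpairing; odd indices
  -- escape along `ℕ`.
  · refine ⟨fun n => if Even n then Sum.inl (denseSeq A (n / 2).unpair.1) else Sum.inr n,
      ?_, ?_, ?_⟩
    · intro n k h
      by_cases hn : Even n
      · simp [hn] at h
      · simpa [hn, eq_comm] using h
    · intro N
      exact ⟨2 * N + 1, by omega, by simp⟩
    · intro U hU hne N
      obtain ⟨i, hi⟩ := (denseRange_denseSeq A).exists_mem_open hU hne
      exact ⟨2 * Nat.pair i N, by have := Nat.right_le_pair i N; omega, _, hi, by simp⟩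

theorem exists_good_measure_probability {D : Set ℝ} (hD : IsGroupLike D 1) :
    ∃ (X : Type) (_ : TopologicalSpace X) (_ : MeasurableSpace X) (_ : BorelSpace X)
      (μ : Measure X), IsNoncompactLCCantor X ∧ MemMZero μ ∧ μ Set.univ = 1 ∧
        IsGood μ ∧ compactOpenValues μ = D := by
  obtain ⟨c, h0, hc, hcof⟩ := hD.exists_cofinal
  -- With nothing at infinity, recurrence is vacuous and the block lengths may shrink.
  obtain ⟨r, hr, hr', -⟩ := exists_base_sequence Empty
  obtain ⟨G, h⟩ := hD.exists_isGluing (r := r) h0 hc hcof hr hr' fun U _ hU => hU.some.elim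
  exact ⟨Glued r c, inferInstance, inferInstance, inferInstance, h.measure,
    h.isNoncompactLCCantor, h.memMZero, h.measure_univ, h.isGood, h.compactOpenValues_eq⟩

theorem exists_good_measure_nondefective {D : Set ℝ} (hD : IsGroupLike D ∞) (A : Type*)
    [TopologicalSpace A] (hA : IsLCZeroDimSepMetrizable A) :
    ∃ (X : Type) (_ : TopologicalSpace X) (_ : MeasurableSpace X) (_ : BorelSpace X)
      (μ : Measure X), IsNoncompactLCCantor X ∧ MemMZero μ ∧ IsNondefective μ ∧
        IsGood μ ∧ compactOpenValues μ = D ∧ Nonempty (defectiveSet μ ≃ₜ A) := by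
  have := hA.metrizable
  have := hA.separable
  have := hA.locallyCompact
  have : SecondCountableTopology A := by
    let _ := metrizableSpaceMetric A
    exact UniformSpace.secondCountable_of_separable A
  have := totallySeparatedSpace_of_t0_of_basis_clopen hA.zeroDim
  -- `A` may live in any universe; its copy in `ℓ^∞` lets `X` be built in `Type`.
  obtain ⟨f, hf⟩ := exists_embedding_l_infty A
  let e : A ≃ₜ Set.range f := hf.toHomeomorph
  have : SecondCountableTopology (Set.range f) := e.symm.isEmbedding.secondCountableTopology
  have : LocallyCompactSpace (Set.range f) := e.symm.isClosedEmbedding.locallyCompactSpace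
  have : TotallyDisconnectedSpace (Set.range f) := e.totallyDisconnectedSpace
  obtain ⟨t, ht, c, hc⟩ := hD.exists_arithmetic
  obtain ⟨r, hr, hr', hrec⟩ := exists_base_sequence (Set.range f)
  obtain ⟨G, h⟩ := hD.exists_isGluing (r := r) (c := c) (by simp [hc])
    (strictMono_nat_of_lt_succ fun n => by
      rw [← Subtype.coe_lt_coe, hc, hc]; push_cast; linarith)
    (fun x => by
      obtain ⟨n, hn⟩ := exists_nat_ge ((x : ℝ) / t)
      rw [div_le_iff₀ ht] at hn
      exact ⟨n, by rwa [← Subtype.coe_le_coe, hc]⟩) hr hr'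
    (fun U hU hne => ⟨t, ht, fun N => by
      obtain ⟨n, hn, hnU⟩ := hrec U hU hne N
      exact ⟨n, hn, hnU, by rw [hc, hc]; push_cast; linarith⟩⟩)
  obtain ⟨e'⟩ := h.nonempty_homeomorph
  refine ⟨Glued r c, inferInstance, inferInstance, inferInstance, h.measure,
    h.isNoncompactLCCantor, h.memMZero, ⟨h.measure_univ, ?_⟩, h.isGood, h.compactOpenValues_eq,
    ⟨e'.trans e.symm⟩⟩
  rw [h.defectiveSet_eq]
  exact h.measure_topSet

end LCCantor

theorem theorem2p10 :
    (∀ (X : Type*) [TopologicalSpace X] [MeasurableSpace X] [BorelSpace X] (μ : Measure X),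
      LCCantor.IsNoncompactLCCantor X → LCCantor.MemMZero μ → LCCantor.IsGood μ →
        LCCantor.IsGroupLike (LCCantor.compactOpenValues μ) (μ Set.univ) ∧
        LCCantor.IsLCZeroDimSepMetrizable (LCCantor.defectiveSet μ)) ∧
    (∀ D : Set ℝ, LCCantor.IsGroupLike D 1 →
      ∃ (X : Type) (_ : TopologicalSpace X) (_ : MeasurableSpace X) (_ : BorelSpace X)
        (μ : Measure X),
        LCCantor.IsNoncompactLCCantor X ∧ LCCantor.MemMZero μ ∧ μ Set.univ = 1 ∧
        LCCantor.IsGood μ ∧ LCCantor.compactOpenValues μ = D) ∧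
    (∀ D : Set ℝ, LCCantor.IsGroupLike D ∞ →
      ∀ (A : Type*) [TopologicalSpace A], LCCantor.IsLCZeroDimSepMetrizable A →
      ∃ (X : Type) (_ : TopologicalSpace X) (_ : MeasurableSpace X) (_ : BorelSpace X)
        (μ : Measure X),
        LCCantor.IsNoncompactLCCantor X ∧ LCCantor.MemMZero μ ∧ LCCantor.IsNondefective μ ∧
        LCCantor.IsGood μ ∧ LCCantor.compactOpenValues μ = D ∧
        Nonempty (LCCantor.defectiveSet μ ≃ₜ A)) := by
  exact ⟨fun X _ _ _ μ h hμ hg => ⟨hg.isGroupLike h hμ,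
    LCCantor.isLCZeroDimSepMetrizable_defectiveSet h⟩,
    fun D hD => LCCantor.exists_good_measure_probability hD,
    fun D hD A _ hA => LCCantor.exists_good_measure_nondefective hD A hA⟩
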